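/- Let $\Sigma=CS\cup FS$ be a first-order signature with disjoint sets of constructor symbols ($CS$) and function symbols ($FS$), each symbol with an arity, and let $\mathcal V$ be an infinite set of variables. **Syntax.** $LExp$ is the set of let-expressions $e ::= X \mid h(e_1,\dots,e_n)\mid let~X=e_1~in~e_2$ ($X\in\mathcal V$, $h\in\Sigma$ of arity $n$), where $let~X=e_1~in~e_2$ binds $X$ in $e_2$ but not in $e_1$; bound variables may be renamed, and substitution is capture-avoiding. $CTerm$ is the set of c-terms, built from variables and constructor symbols only. Adding a constant $\perp$ gives $LExp_\perp$ and $CTerm_\perp$. $CSubst$ (resp. $CSubst_\perp$) is the set of substitutions with finite domain and values in $CTerm$ (resp. $CTerm_\perp$). A program $\mathcal P$ is any set of rules $f(p_1,\dots,p_n)\to r$ with $f\in FS$ of arity $n$, $(p_1,\dots,p_n)$ a tuple of c-terms in which no variable occurs twice, and $r\in LExp$; $r$ may contain extra variables. **Shell.** $|X|=X$, $|\perp|=\perp$, $|c(e_1,\dots,e_n)|=c(|e_1|,\dots,|e_n|)$ for $c\in CS$, $|f(e_1,\dots,e_n)|=\perp$ for $f\in FS$, and $|let~X=e_1~in~e_2|=|e_2|[X/|e_1|]$.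 **Let-rewriting** $\to^l$ (under $\mathcal P$) is given by the rules * (Fapp) $f(p_1,\dots,p_n)\theta\to^l r\theta$ if $(f(p_1,\dots,p_n)\to r)\in\mathcal P$ and $\theta\in CSubst$; * (LetIn) $h(\dots,e,\dots)\to^l let~X=e~in~h(\dots,X,\dots)$ if $h\in\Sigma$, $e$ is a let-expression $let~Y=e'~in~e''$ or is rooted by a function symbol, and $X$ is fresh; * (Bind) $let~X=t~in~e\to^l e[X/t]$ if $t\in CTerm$; * (Elim) $let~X=e_1~in~e_2\to^l e_2$ if $X$ is not free in $e_2$; * (Flat) $let~X=(let~Y=e_1~in~e_2)~in~e_3\to^l let~Y=e_1~in~(let~X=e_2~in~e_3)$ if $Y$ is not free in $e_3$; * (Contx) $\mathcal C[e]\to^l\mathcal C[e']$ for every one-hole context $\mathcal C\neq[\,]$, if $e\to^l e'$ by one of the previous rules, where for a (Fapp) step with rule $f(\overline p)\to r$ and substitution $\theta$ no variable let-bound by $\mathcal C$ at its hole may occur in a term $X\theta\ne X$ with $X\notin var(\overline p)$. **Calculi.** $CRWL_{let}$ derives statements $e\rightarrowtriangle t$ ($e\in LExp_\perp$, $t\in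 CTerm_\perp$) by the rules * (B) $e\rightarrowtriangle\perp$; * (RR) $X\rightarrowtriangle X$ for $X\in\mathcal V$; * (DC) from $e_i\rightarrowtriangle t_i$ ($1\le i\le n$) infer $c(e_1,\dots,e_n)\rightarrowtriangle c(t_1,\dots,t_n)$, for $c\in CS$; * (OR) from $e_i\rightarrowtriangle p_i\theta$ ($1\le i\le n$) and $r\theta\rightarrowtriangle t$ infer $f(e_1,\dots,e_n)\rightarrowtriangle t$, for $(f(p_1,\dots,p_n)\to r)\in\mathcal P$ and $\theta\in CSubst_\perp$; * (Let) from $e_1\rightarrowtriangle t_1$ and $e_2[X/t_1]\rightarrowtriangle t$ infer $let~X=e_1~in~e_2\rightarrowtriangle t$. $CRWL$ is the calculus with the rules (B), (RR), (DC), (OR) only, on expressions without lets. **Theorem (Soundness of let-rewriting).** For every program $\mathcal P$ and every $e\in LExp$: 1. $e\to^{l*}e'$ implies $\mathcal P\vdash_{CRWL_{let}}e\rightarrowtriangle|e'|$, for every $e'\in LExp$. 2. $e\to^{l*}t$ implies $\mathcal P\vdash_{CRWL_{let}}e\rightarrowtriangle t$, for every $t\in CTerm$. If moreover neither $\mathcal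 P$ nor $e$ contains lets, then: 3. $e\to^{l*}e'$ implies $\mathcal P\vdash_{CRWL}e\rightarrowtriangle|e'|$, for every $e'\in LExp$. 4. $e\to^{l*}t$ implies $\mathcal P\vdash_{CRWL}e\rightarrowtriangle t$, for every $t\in CTerm$. Finally, let-rewriting can only shrink the hyperdenotation: 5. for every $e'\in LExp$ with $e\to^{l*}e'$ and every $\theta\in CSubst_\perp$, $\{t\in CTerm_\perp\mid\mathcal P\vdash_{CRWL_{let}}e'\theta\rightarrowtriangle t\}\subseteq\{t\in CTerm_\perp\mid\mathcal P\vdash_{CRWL_{let}}e\theta\rightarrowtriangle t\}$. -/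

import Mathlib

namespace LetRw

/-- A first-order signature: disjoint sets of constructor symbols and of defined function
symbols, each symbol with an arity. -/
structure Signature where
  CS : Type*
  FS : Type*
  carity : CS → ℕ
  farity : FS → ℕ

namespace Signature

/-- All symbols `h ∈ Σ = CS ∪ FS` (a disjoint union). -/
abbrev Sym (S : Signature) := S.CS ⊕ S.FS

/-- The arity of a symbol. -/
abbrev arity (S : Signature) : S.Sym → ℕ
  | Sum.inl c => S.carity c
  | Sum.inr f => S.farity f

end Signature

/-- Raw (named) partial let-expressions, the set `LExp_⊥`:
`e ::= X | ⊥ | h(e₁,…,eₙ) | let X = e₁ in e₂`.  The other syntactic categories are the subsets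
singled out by the predicates below. -/
inductive PLExp (S : Signature) (V : Type*) where
  | var (X : V) : PLExp S V
  | bot : PLExp S V
  | app (h : S.Sym) (args : Fin (S.arity h) → PLExp S V) : PLExp S V
  | letIn (X : V) (e₁ e₂ : PLExp S V) : PLExp S V

/-- Substitutions, as maps on variables; finiteness of the domain is part of `IsCSubst` and
`IsPCSubst`. -/
abbrev Subst (S : Signature) (V : Type*) := V → PLExp S V

namespace PLExp

variable {S : Signature} {V : Type*}

/-- `c(e₁,…,eₙ)` for a constructor symbol `c`. -/
abbrev con (c : S.CS) (args : Fin (S.carity c) → PLExp S V) : PLExp S V :=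
  app (Sum.inl c) args

/-- `f(e₁,…,eₙ)` for a function symbol `f`. -/
abbrev fn (f : S.FS) (args : Fin (S.farity f) → PLExp S V) : PLExp S V :=
  app (Sum.inr f) args

/-- `e ∈ LExp`: the symbol `⊥` does not occur in `e`. -/
def IsLExp : PLExp S V → Prop
  | var _ => True
  | bot => False
  | app _ args => ∀ i, IsLExp (args i)
  | letIn _ e₁ e₂ => IsLExp e₁ ∧ IsLExp e₂

/-- `e ∈ Exp_⊥`: no let occurs in `e`. -/
def LetFree : PLExp S V → Prop
  | var _ => True
  | bot => True
  | app _ args => ∀ i, LetFree (args i)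
  | letIn _ _ _ => False

/-- `e ∈ CTerm_⊥`: `e` is built from variables, constructor symbols and `⊥`. -/
def IsPCTerm : PLExp S V → Prop
  | var _ => True
  | bot => True
  | app (Sum.inl _) args => ∀ i, IsPCTerm (args i)
  | app (Sum.inr _) _ => False
  | letIn _ _ _ => False

/-- `e ∈ CTerm`: `e` is built from variables and constructor symbols. -/
def IsCTerm : PLExp S V → Prop
  | var _ => True
  | bot => False
  | app (Sum.inl _) args => ∀ i, IsCTerm (args i)
  | app (Sum.inr _) _ => False
  | letIn _ _ _ => False

/-- `e` is of the form `f(e₁,…,eₙ)` with `f ∈ FS`, or is a let-expression. -/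
def FnOrLetRooted : PLExp S V → Prop
  | var _ => False
  | bot => False
  | app (Sum.inl _) _ => False
  | app (Sum.inr _) _ => True
  | letIn _ _ _ => True

variable [DecidableEq V]

/-- Free variables. -/
def FV : PLExp S V → Finset V
  | var X => {X}
  | bot => ∅
  | app _ args => Finset.univ.biUnion fun i => FV (args i)
  | letIn X e₁ e₂ => FV e₁ ∪ (FV e₂ \ {X})

/-- The number of free occurrences of the variable `Y`. -/
def occ (Y : V) : PLExp S V → ℕ
  | var X => if X = Y then 1 else 0
  | bot => 0
  | app _ args => ∑ i, occ Y (args i)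
  | letIn X e₁ e₂ => occ Y e₁ + if X = Y then 0 else occ Y e₂

variable [Infinite V]

/-- A name for a binder `X` that has to avoid the finite set `A`: `X` itself if it is not in `A`,
otherwise some variable outside `A`. -/
noncomputable def rename (X : V) (A : Finset V) : V :=
  if X ∈ A then (Infinite.exists_notMem_finset A).choose else X

/-- Capture-avoiding application `eσ` of a substitution: a bound variable is renamed whenever it
occurs in the image of a variable that is free in the let-expression's body. -/
noncomputable def subst : PLExp S V → Subst S V → PLExp S V
  | var X, σ => σ X
  | bot, _ => bot
  | app h args, σ => app h fun i => subst (args i) σ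
  | letIn X e₁ e₂, σ =>
      let Z := rename X ((FV e₂ \ {X}).biUnion fun Y => FV (σ Y))
      letIn Z (subst e₁ σ) (subst e₂ (Function.update σ X (var Z)))

/-- The substitution `[X/e]`. -/
def single (X : V) (e : PLExp S V) : Subst S V := Function.update var X e

/-- The shell `|e|`: the outer constructor part of `e`. -/
noncomputable def shell : PLExp S V → PLExp S V
  | var X => var X
  | bot => bot
  | app (Sum.inl c) args => con c fun i => shell (args i)
  | app (Sum.inr _) _ => bot
  | letIn X e₁ e₂ => (shell e₂).subst (single X (shell e₁))

/-- Equality up to renaming of bound variables: the least congruence that identifies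
`let X = e₁ in e₂` with `let Z = e₁ in e₂[X/Z]` for `Z` not free in `e₂`. -/
inductive AlphaEq : PLExp S V → PLExp S V → Prop
  | rename (X Z : V) (e₁ e₂ : PLExp S V) (hZ : Z ∉ FV e₂) :
      AlphaEq (letIn X e₁ e₂) (letIn Z e₁ (e₂.subst (single X (var Z))))
  | refl (e : PLExp S V) : AlphaEq e e
  | symm {e e' : PLExp S V} : AlphaEq e e' → AlphaEq e' e
  | trans {e e' e'' : PLExp S V} : AlphaEq e e' → AlphaEq e' e'' → AlphaEq e e''
  | app (h : S.Sym) (args args' : Fin (S.arity h) → PLExp S V) :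
      (∀ i, AlphaEq (args i) (args' i)) → AlphaEq (app h args) (app h args')
  | letIn (X : V) {e₁ e₁' e₂ e₂' : PLExp S V} :
      AlphaEq e₁ e₁' → AlphaEq e₂ e₂' → AlphaEq (letIn X e₁ e₂) (letIn X e₁' e₂')

end PLExp

namespace Subst

variable {S : Signature} {V : Type*}

/-- The domain of a substitution. -/
def dom (σ : Subst S V) : Set V := {X | σ X ≠ PLExp.var X}

/-- The variable range of a substitution. -/
def vran [DecidableEq V] (σ : Subst S V) : Set V := {Y | ∃ X ∈ σ.dom, Y ∈ (σ X).FV}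

/-- `σ|_{∖D}`: the restriction of `σ` to the variables outside `D`. -/
def restrictCompl [DecidableEq V] (σ : Subst S V) (D : Finset V) : Subst S V :=
  fun X => if X ∈ D then PLExp.var X else σ X

/-- `σ ∈ CSubst`. -/
def IsCSubst (σ : Subst S V) : Prop := σ.dom.Finite ∧ ∀ X, (σ X).IsCTerm

/-- `σ ∈ CSubst_⊥`. -/
def IsPCSubst (σ : Subst S V) : Prop := σ.dom.Finite ∧ ∀ X, (σ X).IsPCTerm

end Subst

/-- Program rules `f(p₁,…,pₙ) → r`: the tuple of patterns is a linear tuple of c-terms and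
`r ∈ LExp`.  Extra variables in `r` are allowed. -/
structure ProgRule (S : Signature) (V : Type*) [DecidableEq V] where
  f : S.FS
  pats : Fin (S.farity f) → PLExp S V
  rhs : PLExp S V
  pats_cterm : ∀ i, (pats i).IsCTerm
  linear : ∀ X : V, ∑ i, (pats i).occ X ≤ 1
  rhs_lexp : rhs.IsLExp

/-- The variables of the left-hand side of a rule. -/
def ProgRule.patVars {S : Signature} {V : Type*} [DecidableEq V] (R : ProgRule S V) : Finset V :=
  Finset.univ.biUnion fun i => (R.pats i).FV

/-- A program is any set of program rules. -/
abbrev Program (S : Signature) (V : Type*) [DecidableEq V] := Set (ProgRule S V)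

/-- A program without lets. -/
def Program.LetFree {S : Signature} {V : Type*} [DecidableEq V] (P : Program S V) : Prop :=
  ∀ R ∈ P, R.rhs.LetFree

/-- One-hole contexts. In `app h i args C` the hole is inside the `i`-th argument, and the value
`args i` is not used. -/
inductive Ctx (S : Signature) (V : Type*) where
  | hole : Ctx S V
  | app (h : S.Sym) (i : Fin (S.arity h)) (args : Fin (S.arity h) → PLExp S V) (C : Ctx S V) :
      Ctx S V
  | letDef (X : V) (C : Ctx S V) (e : PLExp S V) : Ctx S V
  | letBody (X : V) (e : PLExp S V) (C : Ctx S V) : Ctx S V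

namespace Ctx

variable {S : Signature} {V : Type*}

/-- `C[e]`; variables of `e` may be captured. -/
def plug : Ctx S V → PLExp S V → PLExp S V
  | hole, e => e
  | app h i args C, e => PLExp.app h (Function.update args i (C.plug e))
  | letDef X C e', e => PLExp.letIn X (C.plug e) e'
  | letBody X e' C, e => PLExp.letIn X e' (C.plug e)

/-- The variables bound by a context: the let-bound variables visible from the hole. -/
def BV [DecidableEq V] : Ctx S V → Finset V
  | hole => ∅
  | app _ _ _ C => C.BV
  | letDef _ C _ => C.BV
  | letBody X _ C => {X} ∪ C.BV

end Ctx

section Calculi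

variable {S : Signature} {V : Type*} [DecidableEq V] [Infinite V]

open PLExp

/-- The rules (LetIn), (Bind), (Elim) and (Flat) of let-rewriting, applied at the root. -/
inductive PeelStep : PLExp S V → PLExp S V → Prop
  | letIn (h : S.Sym) (args : Fin (S.arity h) → PLExp S V) (i : Fin (S.arity h)) (X : V) :
      (args i).FnOrLetRooted → X ∉ (app h args).FV →
      PeelStep (app h args) (letIn X (args i) (app h (Function.update args i (var X))))
  | bind (X : V) (t e : PLExp S V) : t.IsCTerm → PeelStep (letIn X t e) (e.subst (single X t))
  | elim (X : V) (e₁ e₂ : PLExp S V) : X ∉ e₂.FV → PeelStep (letIn X e₁ e₂) e₂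
  | flat (X Y : V) (e₁ e₂ e₃ : PLExp S V) : Y ∉ e₃.FV →
      PeelStep (letIn X (letIn Y e₁ e₂) e₃) (letIn Y e₁ (letIn X e₂ e₃))

/-- One step of let-rewriting under the program `P`: (Fapp), the peeling rules, and (Contx) for
both, where a (Fapp) step inside a context must not introduce, through the instantiation of
variables outside the left-hand side, variables that the context binds. -/
inductive Step (P : Program S V) : PLExp S V → PLExp S V → Prop
  | fapp (R : ProgRule S V) (θ : Subst S V) : R ∈ P → θ.IsCSubst →
      Step P (fn R.f fun i => (R.pats i).subst θ) (R.rhs.subst θ)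
  | peel {e e' : PLExp S V} : PeelStep e e' → Step P e e'
  | contxFapp (C : Ctx S V) (R : ProgRule S V) (θ : Subst S V) : C ≠ Ctx.hole →
      R ∈ P → θ.IsCSubst → Disjoint (θ.restrictCompl R.patVars).vran (C.BV : Set V) →
      Step P (C.plug (fn R.f fun i => (R.pats i).subst θ)) (C.plug (R.rhs.subst θ))
  | contxPeel (C : Ctx S V) {e e' : PLExp S V} : C ≠ Ctx.hole → PeelStep e e' →
      Step P (C.plug e) (C.plug e')

/-- Let-rewriting in any number of steps, where bound variables may be renamed at any moment. -/
def LetRewrites (P : Program S V) : PLExp S V → PLExp S V → Prop :=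
  Relation.ReflTransGen fun e e' => Step P e e' ∨ AlphaEq e e'

/-- Derivability of `e ⇾ t` in the `CRWL` calculus, for `e ∈ Exp_⊥`. -/
inductive CRWL (P : Program S V) : PLExp S V → PLExp S V → Prop
  | B (e : PLExp S V) : e.LetFree → CRWL P e bot
  | RR (X : V) : CRWL P (var X) (var X)
  | DC (c : S.CS) (es ts : Fin (S.carity c) → PLExp S V) :
      (∀ i, CRWL P (es i) (ts i)) → CRWL P (con c es) (con c ts)
  | OR (R : ProgRule S V) (θ : Subst S V) (es : Fin (S.farity R.f) → PLExp S V) (t : PLExp S V) :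
      R ∈ P → θ.IsPCSubst → (∀ i, CRWL P (es i) ((R.pats i).subst θ)) →
      CRWL P (R.rhs.subst θ) t → CRWL P (fn R.f es) t

/-- Derivability of `e ⇾ t` in the `CRWL_let` calculus, for `e ∈ LExp_⊥`. -/
inductive CRWLlet (P : Program S V) : PLExp S V → PLExp S V → Prop
  | B (e : PLExp S V) : CRWLlet P e bot
  | RR (X : V) : CRWLlet P (var X) (var X)
  | DC (c : S.CS) (es ts : Fin (S.carity c) → PLExp S V) :
      (∀ i, CRWLlet P (es i) (ts i)) → CRWLlet P (con c es) (con c ts)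
  | OR (R : ProgRule S V) (θ : Subst S V) (es : Fin (S.farity R.f) → PLExp S V) (t : PLExp S V) :
      R ∈ P → θ.IsPCSubst → (∀ i, CRWLlet P (es i) ((R.pats i).subst θ)) →
      CRWLlet P (R.rhs.subst θ) t → CRWLlet P (fn R.f es) t
  | Let (X : V) (e₁ e₂ t₁ t : PLExp S V) :
      CRWLlet P e₁ t₁ → CRWLlet P (e₂.subst (single X t₁)) t → CRWLlet P (letIn X e₁ e₂) t

/-- The `CRWL_let`-denotation of an expression. -/
def den (P : Program S V) (e : PLExp S V) : Set (PLExp S V) :=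
  {t | t.IsPCTerm ∧ CRWLlet P e t}

/-- The hyperdenotation of an expression: it maps `θ ∈ CSubst_⊥` to the denotation of `eθ`. -/
def hyperDen (P : Program S V) (e : PLExp S V) (θ : {θ : Subst S V // θ.IsPCSubst}) :
    Set (PLExp S V) :=
  den P (e.subst θ.1)

end Calculi

end LetRw

/-! The calculus is awkward under binders: (Let) substitutes, and substitution renames. So
`CRWL_let` is replaced by a compositional semantics `eval P e σ t`, where an environment `σ` of
partial c-terms gives each variable one fixed value (call-time choice) and a let extends `σ`. It is
structurally recursive in `e`, because unfolding a program rule is delegated to an actual `CRWLlet`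
derivation. By the substitution lemma `eval_subst`, environments and substitutions by partial
c-terms are interchangeable, so `eσ ⇾ t` holds iff `eval P e σ t` (`CRWLlet_subst_iff_eval`).

Let-rewriting then only has to shrink the set of values in every environment (`Refines`). This is
checked for each root rule and for renaming, and it passes through contexts because all environments
are considered. That is the claim on hyperdenotations. Shell soundness follows since `|e'|` is
itself a value of `e'` (`eval_shell`), and a c-term is its own shell. Without lets, the derivation
found never uses (Let). -/

namespace LetRw

open PLExp

section Soundness

variable {S : Signature} {V : Type*}

/-! ### Approximation order and syntactic classes -/

/-- The approximation order on partial c-terms: `Approx t s` says that `s` arises from `t` by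
replacing subterms by `⊥`. -/
inductive Approx : PLExp S V → PLExp S V → Prop
  | bot (t : PLExp S V) : Approx t bot
  | var (X : V) : Approx (var X) (var X)
  | con (c : S.CS) (ts ss : Fin (S.carity c) → PLExp S V) :
      (∀ i, Approx (ts i) (ss i)) → Approx (con c ts) (con c ss)

theorem Approx.of_bot {t : PLExp S V} (h : Approx PLExp.bot t) : t = PLExp.bot := by
  cases h; rfl

theorem Approx.refl {t : PLExp S V} (ht : t.IsPCTerm) : Approx t t := by
  induction t with
  | var X => exact .var X
  | bot => exact .bot _
  | app h args ih =>
    cases h with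
    | inl c => exact .con c _ _ fun i => ih i (ht i)
    | inr f => exact ht.elim
  | letIn X e₁ e₂ => exact ht.elim

theorem Approx.trans {t s r : PLExp S V} (h : Approx t s) (h' : Approx s r) : Approx t r := by
  induction h generalizing r with
  | bot t => rw [h'.of_bot]; exact .bot _
  | var X => exact h'
  | con c ts ss _ ih =>
    cases h' with
    | bot => exact .bot _
    | con _ _ rs hr => exact .con c _ _ fun i => ih i (hr i)

theorem Approx.isPCTerm {t s : PLExp S V} (h : Approx t s) : s.IsPCTerm := by
  induction h with
  | bot => trivial
  | var => trivial
  | con c ts ss _ ih => exact ih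

theorem PLExp.IsCTerm.isPCTerm {t : PLExp S V} (ht : t.IsCTerm) : t.IsPCTerm := by
  induction t with
  | var X => trivial
  | bot => trivial
  | app h args ih =>
    cases h with
    | inl c => exact fun i => ih i (ht i)
    | inr f => exact ht.elim
  | letIn X e₁ e₂ => exact ht.elim

theorem PLExp.IsPCTerm.letFree {t : PLExp S V} (ht : t.IsPCTerm) : t.LetFree := by
  induction t with
  | var X => trivial
  | bot => trivial
  | app h args ih =>
    cases h with
    | inl c => exact fun i => ih i (ht i)
    | inr f => exact ht.elim
  | letIn X e₁ e₂ => exact ht.elim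

theorem Subst.isPCSubst_var : Subst.IsPCSubst (PLExp.var : Subst S V) :=
  ⟨by simp [Subst.dom], fun _ => trivial⟩

theorem Subst.IsCSubst.isPCSubst {σ : Subst S V} (hσ : σ.IsCSubst) : σ.IsPCSubst :=
  ⟨hσ.1, fun X => (hσ.2 X).isPCTerm⟩

/-- `Skel s e`: the expression `e` has the shape of `s`, up to the names of bound variables and
up to partial c-terms in place of variables. -/
def Skel : PLExp S V → PLExp S V → Prop
  | var _, e => e.IsPCTerm
  | bot, e => e = bot
  | app h args, e => ∃ args', e = app h args' ∧ ∀ i, Skel (args i) (args' i)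
  | letIn _ e₁ e₂, e => ∃ X e₁' e₂', e = letIn X e₁' e₂' ∧ Skel e₁ e₁' ∧ Skel e₂ e₂'

theorem Skel.refl (e : PLExp S V) : Skel e e := by
  induction e with
  | var X => trivial
  | bot => rfl
  | app h args ih => exact ⟨args, rfl, ih⟩
  | letIn X e₁ e₂ ih₁ ih₂ => exact ⟨X, e₁, e₂, rfl, ih₁, ih₂⟩

/-! ### Free variables and substitution -/

variable [DecidableEq V]

theorem PLExp.mem_FV_app {h : S.Sym} {args : Fin (S.arity h) → PLExp S V} {X : V} :
    X ∈ (app h args).FV ↔ ∃ i, X ∈ (args i).FV := by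
  simp [FV]

theorem PLExp.mem_FV_letIn {Y X : V} {e₁ e₂ : PLExp S V} :
    X ∈ (letIn Y e₁ e₂).FV ↔ X ∈ e₁.FV ∨ X ∈ e₂.FV ∧ X ≠ Y := by
  simp [FV]

theorem Subst.IsPCSubst.update {σ : Subst S V} (hσ : σ.IsPCSubst) (X : V) {t : PLExp S V}
    (ht : t.IsPCTerm) : Subst.IsPCSubst (Function.update σ X t) := by
  refine ⟨(hσ.1.insert X).subset fun Y hY => ?_, fun Y => ?_⟩
  · by_cases h : Y = X
    · exact Or.inl h
    · refine Or.inr ?_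
      simpa [Subst.dom, Function.update_of_ne h] using hY
  · by_cases h : Y = X
    · subst h; simpa using ht
    · simpa [Function.update_of_ne h] using hσ.2 Y

theorem Subst.IsPCSubst.single (X : V) {t : PLExp S V} (ht : t.IsPCTerm) :
    Subst.IsPCSubst (PLExp.single X t) :=
  Subst.isPCSubst_var.update X ht

variable [Infinite V]

theorem PLExp.rename_notMem (X : V) (A : Finset V) : rename X A ∉ A := by
  unfold rename
  split_ifs with h
  · exact (Infinite.exists_notMem_finset A).choose_spec
  · exact h

theorem PLExp.subst_var (e : PLExp S V) : e.subst var = e := by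
  induction e with
  | var X => rfl
  | bot => rfl
  | app h args ih => simp [subst, ih]
  | letIn X e₁ e₂ ih₁ ih₂ =>
    -- Only `X` could be captured here, and it is removed from the set to avoid, so the binder keeps
    -- its name.
    have hZ : rename X ((FV e₂ \ {X}).biUnion fun Y => FV (var (S := S) Y)) = X := by
      simp [rename, FV]
    simp only [subst, hZ, ih₁, Function.update_eq_self, ih₂]

theorem PLExp.IsPCTerm.subst {t : PLExp S V} (ht : t.IsPCTerm) {σ : Subst S V}
    (hσ : ∀ X, (σ X).IsPCTerm) : (t.subst σ).IsPCTerm := by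
  induction t with
  | var X => exact hσ X
  | bot => trivial
  | app h args ih =>
    cases h with
    | inl c => exact fun i => ih i (ht i)
    | inr f => exact ht.elim
  | letIn X e₁ e₂ => exact ht.elim

theorem PLExp.LetFree.subst {t : PLExp S V} (ht : t.LetFree) {σ : Subst S V}
    (hσ : ∀ X, (σ X).LetFree) : (t.subst σ).LetFree := by
  induction t with
  | var X => exact hσ X
  | bot => trivial
  | app h args ih => exact fun i => ih i (ht i)
  | letIn X e₁ e₂ => exact ht.elim

/-- Without binders nothing is renamed, so composition holds as an equality and not merely up to
`AlphaEq`. -/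
theorem PLExp.LetFree.subst_subst {t : PLExp S V} (ht : t.LetFree) (σ τ : Subst S V) :
    (t.subst σ).subst τ = t.subst fun X => (σ X).subst τ := by
  induction t with
  | var X => rfl
  | bot => rfl
  | app h args ih => simp only [PLExp.subst, fun i => ih i (ht i)]
  | letIn X e₁ e₂ => exact ht.elim

theorem PLExp.LetFree.subst_congr {t : PLExp S V} (ht : t.LetFree) {σ τ : Subst S V}
    (h : ∀ X ∈ t.FV, σ X = τ X) : t.subst σ = t.subst τ := by
  induction t with
  | var X => exact h X (by simp [FV])
  | bot => rfl
  | app f args ih =>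
    simp only [PLExp.subst]
    congr 1
    funext i
    exact ih i (ht i) fun X hX => h X (mem_FV_app.2 ⟨i, hX⟩)
  | letIn X e₁ e₂ => exact ht.elim

theorem PLExp.single_subst (X : V) (t : PLExp S V) (σ : Subst S V) :
    (fun Y => (single X t Y).subst σ) = Function.update σ X (t.subst σ) := by
  funext Y
  by_cases h : Y = X
  · subst h; simp [single]
  · simp [single, Function.update_of_ne h, PLExp.subst]

theorem Subst.IsPCSubst.comp {σ τ : Subst S V} (hσ : σ.IsPCSubst) (hτ : τ.IsPCSubst) :
    Subst.IsPCSubst fun X => (σ X).subst τ := by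
  refine ⟨(hσ.1.union hτ.1).subset fun X hX => ?_, fun X => (hσ.2 X).subst hτ.2⟩
  by_contra h
  simp only [Subst.dom, Set.mem_union, Set.mem_ofPred_eq, not_or, not_not] at h
  exact hX (by simp [h.1, PLExp.subst, h.2])

theorem PLExp.IsCTerm.shell_eq {t : PLExp S V} (ht : t.IsCTerm) : t.shell = t := by
  induction t with
  | var X => rfl
  | bot => rfl
  | app h args ih =>
    cases h with
    | inl c => simp only [shell, fun i => ih i (ht i)]
    | inr f => exact ht.elim
  | letIn X e₁ e₂ => exact ht.elim

theorem PLExp.isPCTerm_shell (e : PLExp S V) : e.shell.IsPCTerm := by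
  induction e with
  | var X => trivial
  | bot => trivial
  | app h args ih =>
    cases h with
    | inl c => exact ih
    | inr f => trivial
  | letIn X e₁ e₂ ih₁ ih₂ => exact ih₂.subst (Subst.IsPCSubst.single X ih₁).2

/-! ### Downward closure of derivable values -/

variable {P : Program S V}

theorem CRWLlet.isPCTerm {e t : PLExp S V} (h : CRWLlet P e t) : t.IsPCTerm := by
  induction h with
  | B => trivial
  | RR => trivial
  | DC c es ts _ ih => exact ih
  | OR _ _ _ _ _ _ _ _ _ ih => exact ih
  | Let _ _ _ _ _ _ _ _ ih => exact ih

theorem CRWLlet.mono {e t s : PLExp S V} (h : CRWLlet P e t) (hs : Approx t s) :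
    CRWLlet P e s := by
  induction h generalizing s with
  | B e => rw [hs.of_bot]; exact .B e
  | RR X =>
    cases hs with
    | bot => exact .B _
    | var => exact .RR X
  | DC c es ts _ ih =>
    cases hs with
    | bot => exact .B _
    | con _ _ ss hss => exact .DC c es ss fun i => ih i (hss i)
  | OR R θ es t hR hθ hes _ _ ih => exact .OR R θ es s hR hθ hes (ih hs)
  | Let X e₁ e₂ t₁ t h₁ _ _ ih => exact .Let X e₁ e₂ t₁ s h₁ (ih hs)

theorem CRWLlet.of_approx {t s : PLExp S V} (h : Approx t s) : CRWLlet P t s := by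
  induction h with
  | bot t => exact .B t
  | var X => exact .RR X
  | con c ts ss _ ih => exact .DC c ts ss ih

/-! ### Compositional semantics -/

/-- The values of `h(t₁,…,tₙ)` other than `⊥` for argument values `t₁,…,tₙ` that are used
exactly as they are: a constructor is applied to them, a function symbol is unfolded with an
instance of a program rule whose left-hand side they match. -/
inductive SymEval (P : Program S V) :
    (h : S.Sym) → (Fin (S.arity h) → PLExp S V) → PLExp S V → Prop
  | con (c : S.CS) (ts : Fin (S.carity c) → PLExp S V) : SymEval P (Sum.inl c) ts (con c ts)
  | fn (R : ProgRule S V) (θ : Subst S V) (t : PLExp S V) : R ∈ P → θ.IsPCSubst →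
      CRWLlet P (R.rhs.subst θ) t →
      SymEval P (Sum.inr R.f) (fun i => (R.pats i).subst θ) t

theorem SymEval.isPCTerm {h : S.Sym} {ts : Fin (S.arity h) → PLExp S V} {t : PLExp S V}
    (H : SymEval P h ts t) (hts : ∀ i, (ts i).IsPCTerm) : t.IsPCTerm := by
  cases H with
  | con c => exact hts
  | fn R θ _ _ _ ht => exact ht.isPCTerm

/-- A smaller constructor term needs smaller arguments. For a function symbol the arguments must
stay as they are, to match the patterns exactly, and only the value of the right-hand side shrinks.
-/
theorem SymEval.mono {h : S.Sym} {ts : Fin (S.arity h) → PLExp S V} {t s : PLExp S V}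
    (H : SymEval P h ts t) (hts : ∀ i, (ts i).IsPCTerm) (hs : Approx t s) :
    s = bot ∨ ∃ ss, (∀ i, Approx (ts i) (ss i)) ∧ SymEval P h ss s := by
  cases H with
  | con c =>
    cases hs with
    | bot => exact Or.inl rfl
    | con _ _ ss hss => exact Or.inr ⟨ss, hss, .con c ss⟩
  | fn R θ _ hR hθ ht =>
    exact Or.inr ⟨_, fun i => Approx.refl (hts i), .fn R θ s hR hθ (ht.mono hs)⟩

/-- Compositional `CRWL_let`-semantics: `eval P e σ t` says that `t` is a value of `e` in the
environment `σ`. -/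
def eval (P : Program S V) : PLExp S V → Subst S V → PLExp S V → Prop
  | var X, σ, t => Approx (σ X) t
  | bot, _, t => t = bot
  | app h args, σ, t => t = bot ∨ ∃ ts, (∀ i, eval P (args i) σ (ts i)) ∧ SymEval P h ts t
  | letIn X e₁ e₂, σ, t => ∃ t₁, eval P e₁ σ t₁ ∧ eval P e₂ (Function.update σ X t₁) t

theorem eval_bot (P : Program S V) (e : PLExp S V) (σ : Subst S V) : eval P e σ bot := by
  induction e generalizing σ with
  | var X => exact .bot _
  | bot => rfl
  | app h args => exact Or.inl rfl
  | letIn X e₁ e₂ ih₁ ih₂ => exact ⟨bot, ih₁ _, ih₂ _⟩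

theorem eval_isPCTerm {e : PLExp S V} {σ : Subst S V} {t : PLExp S V} (h : eval P e σ t) :
    t.IsPCTerm := by
  induction e generalizing σ t with
  | var X => exact Approx.isPCTerm h
  | bot => rw [show t = bot from h]; trivial
  | app f args ih =>
    obtain rfl | ⟨ts, hts, H⟩ := h
    · trivial
    · exact H.isPCTerm fun i => ih i (hts i)
  | letIn X e₁ e₂ ih₁ ih₂ =>
    obtain ⟨t₁, -, h₂⟩ := h
    exact ih₂ h₂

theorem eval_mono {e : PLExp S V} {σ : Subst S V} {t s : PLExp S V} (h : eval P e σ t)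
    (hs : Approx t s) : eval P e σ s := by
  induction e generalizing σ t s with
  | var X => exact Approx.trans h hs
  | bot => rw [show t = bot from h] at hs; exact hs.of_bot
  | app f args ih =>
    obtain rfl | ⟨ts, hts, H⟩ := h
    · exact Or.inl hs.of_bot
    · obtain rfl | ⟨ss, hss, H'⟩ := H.mono (fun i => eval_isPCTerm (hts i)) hs
      · exact Or.inl rfl
      · exact Or.inr ⟨ss, fun i => ih i (hts i) (hss i), H'⟩
  | letIn X e₁ e₂ ih₁ ih₂ =>
    obtain ⟨t₁, h₁, h₂⟩ := h
    exact ⟨t₁, h₁, ih₂ h₂ hs⟩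

theorem eval_congr {e : PLExp S V} {σ τ : Subst S V} (h : ∀ X ∈ e.FV, σ X = τ X)
    {t : PLExp S V} : eval P e σ t ↔ eval P e τ t := by
  induction e generalizing σ τ t with
  | var X => simp only [eval, h X (by simp [FV])]
  | bot => rfl
  | app f args ih =>
    simp only [eval, fun i t => ih i (fun X hX => h X (mem_FV_app.2 ⟨i, hX⟩)) (t := t)]
  | letIn X e₁ e₂ ih₁ ih₂ =>
    have h₂ : ∀ t₁, ∀ Y ∈ e₂.FV, Function.update σ X t₁ Y = Function.update τ X t₁ Y := by
      intro t₁ Y hY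
      by_cases hYX : Y = X
      · subst hYX; simp
      · simpa [Function.update_of_ne hYX] using h Y (mem_FV_letIn.2 (Or.inr ⟨hY, hYX⟩))
    exact exists_congr fun t₁ => and_congr
      (ih₁ fun Y hY => h Y (mem_FV_letIn.2 (Or.inl hY))) (ih₂ (h₂ t₁))

theorem eval_update_of_notMem {e : PLExp S V} {X : V} (hX : X ∉ e.FV) {σ : Subst S V}
    {t₁ t : PLExp S V} : eval P e (Function.update σ X t₁) t ↔ eval P e σ t :=
  eval_congr fun _ hY => Function.update_of_ne (ne_of_mem_of_not_mem hY hX) t₁ σ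

theorem eval_iff_approx {s : PLExp S V} (hs : s.IsPCTerm) {σ : Subst S V} {t : PLExp S V} :
    eval P s σ t ↔ Approx (s.subst σ) t := by
  induction s generalizing t with
  | var X => rfl
  | bot => exact ⟨fun h => by rw [show t = bot from h]; exact .bot _, fun h => h.of_bot⟩
  | app h args ih =>
    cases h with
    | inr f => exact hs.elim
    | inl c =>
      constructor
      · rintro (rfl | ⟨ts, hts, H⟩)
        · exact .bot _
        · cases H
          exact .con c _ _ fun i => (ih i (hs i)).1 (hts i)
      · intro H
        cases H with
        | bot => exact Or.inl rfl
        | con _ _ ts hts => exact Or.inr ⟨ts, fun i => (ih i (hs i)).2 (hts i), .con c ts⟩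
  | letIn X e₁ e₂ => exact hs.elim

/-- The substitution lemma. It rests on `σ X` being a partial c-term: such a term has a greatest
value, its instance under `τ`, which can be stored in the environment. -/
theorem eval_subst {e : PLExp S V} {σ : Subst S V} (hσ : ∀ X, (σ X).IsPCTerm) {τ : Subst S V}
    {t : PLExp S V} : eval P (e.subst σ) τ t ↔ eval P e (fun X => (σ X).subst τ) t := by
  induction e generalizing σ τ t with
  | var X => exact eval_iff_approx (hσ X)
  | bot => rfl
  | app h args ih =>
    exact or_congr Iff.rfl (exists_congr fun ts =>
      and_congr (forall_congr' fun i => ih i hσ) Iff.rfl)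
  | letIn X e₁ e₂ ih₁ ih₂ =>
    have hZ := rename_notMem X ((FV e₂ \ {X}).biUnion fun Y => FV (σ Y))
    simp only [PLExp.subst, eval]
    generalize rename X ((FV e₂ \ {X}).biUnion fun Y => FV (σ Y)) = Z at hZ ⊢
    have hσ' : ∀ Y, (Function.update σ X (var Z) Y).IsPCTerm := by
      intro Y
      by_cases hYX : Y = X
      · subst hYX; rw [Function.update_self]; trivial
      · rw [Function.update_of_ne hYX]; exact hσ Y
    refine exists_congr fun t₁ => and_congr (ih₁ hσ) ((ih₂ hσ').trans (eval_congr ?_))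
    intro Y hY
    by_cases hYX : Y = X
    · subst hYX; simp [PLExp.subst]
    -- The new binder `Z` avoids the variables of `σ Y`, so giving `Z` a value does not affect this
    -- image.
    · rw [Function.update_of_ne hYX, Function.update_of_ne hYX]
      refine (hσ Y).letFree.subst_congr fun W hW => Function.update_of_ne ?_ _ _
      rintro rfl
      exact hZ (Finset.mem_biUnion.2 ⟨Y, by simp [hY, hYX], hW⟩)

theorem eval_subst_var {e : PLExp S V} {σ : Subst S V} (hσ : ∀ X, (σ X).IsPCTerm)
    {t : PLExp S V} : eval P (e.subst σ) var t ↔ eval P e σ t := by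
  simp only [eval_subst hσ, subst_var]

/-! ### Equivalence with the calculus -/

theorem eval_of_CRWLlet {e t : PLExp S V} (h : CRWLlet P e t) : eval P e var t := by
  induction h with
  | B e => exact eval_bot P e _
  | RR X => exact .var X
  | DC c es ts _ ih => exact Or.inr ⟨ts, ih, .con c ts⟩
  | OR R θ es t hR hθ _ ht ih _ => exact Or.inr ⟨_, ih, .fn R θ t hR hθ ht⟩
  | Let X e₁ e₂ t₁ t h₁ _ ih₁ ih₂ =>
    exact ⟨t₁, ih₁, (eval_subst_var (Subst.IsPCSubst.single X h₁.isPCTerm).2).1 ih₂⟩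

theorem Skel.subst {s e : PLExp S V} (h : Skel s e) {σ : Subst S V} (hσ : σ.IsPCSubst) :
    Skel s (e.subst σ) := by
  induction s generalizing e σ with
  | var X => exact PLExp.IsPCTerm.subst h hσ.2
  | bot => rw [show e = bot from h]; rfl
  | app f args ih =>
    obtain ⟨args', rfl, h⟩ := h
    exact ⟨_, rfl, fun i => ih i (h i) hσ⟩
  | letIn X e₁ e₂ ih₁ ih₂ =>
    obtain ⟨Y, e₁', e₂', rfl, h₁, h₂⟩ := h
    exact ⟨_, _, _, rfl, ih₁ h₁ hσ, ih₂ h₂ (hσ.update Y trivial)⟩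

/-- In the let case (Let) asks for a derivation from `e₂[X/t₁]`, which is not a subterm. Induction
on a skeleton works because instantiation by partial c-terms preserves it. -/
theorem Skel.CRWLlet_of_eval {s e t : PLExp S V} (hs : Skel s e) (h : eval P e var t) :
    CRWLlet P e t := by
  induction s generalizing e t with
  | var X =>
    have := (eval_iff_approx (show e.IsPCTerm from hs)).1 h
    rw [subst_var] at this
    exact .of_approx this
  | bot =>
    obtain rfl : e = bot := hs
    rw [show t = bot from h]
    exact .B _
  | app f args ih =>
    obtain ⟨args', rfl, hs⟩ := hs
    obtain rfl | ⟨ts, hts, H⟩ := h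
    · exact .B _
    · have hes := fun i => ih i (hs i) (hts i)
      cases H with
      | con c => exact .DC c _ _ hes
      | fn R θ _ hR hθ ht => exact .OR R θ _ _ hR hθ hes ht
  | letIn X e₁ e₂ ih₁ ih₂ =>
    obtain ⟨Y, e₁', e₂', rfl, hs₁, hs₂⟩ := hs
    obtain ⟨t₁, h₁, h₂⟩ := h
    have hσ := Subst.IsPCSubst.single Y (eval_isPCTerm h₁)
    exact .Let Y _ _ t₁ t (ih₁ hs₁ h₁) (ih₂ (hs₂.subst hσ) ((eval_subst_var hσ.2).2 h₂))

theorem CRWLlet_iff_eval {e t : PLExp S V} : CRWLlet P e t ↔ eval P e var t :=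
  ⟨eval_of_CRWLlet, (Skel.refl e).CRWLlet_of_eval⟩

theorem CRWLlet_subst_iff_eval {e : PLExp S V} {σ : Subst S V} (hσ : σ.IsPCSubst)
    {t : PLExp S V} : CRWLlet P (e.subst σ) t ↔ eval P e σ t :=
  CRWLlet_iff_eval.trans (eval_subst_var hσ.2)

/-- For a let, the defined variable receives the instance of the shell of its definition; composing
substitutions turns this into the shell of the whole let. -/
theorem eval_shell (P : Program S V) (e : PLExp S V) {σ : Subst S V}
    (hσ : ∀ X, (σ X).IsPCTerm) : eval P e σ (e.shell.subst σ) := by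
  induction e generalizing σ with
  | var X => exact Approx.refl (hσ X)
  | bot => rfl
  | app h args ih =>
    cases h with
    | inl c => exact Or.inr ⟨_, fun i => ih i hσ, .con c _⟩
    | inr f => exact Or.inl rfl
  | letIn X e₁ e₂ ih₁ ih₂ =>
    refine ⟨_, ih₁ hσ, ?_⟩
    simp only [shell, (isPCTerm_shell e₂).letFree.subst_subst, single_subst]
    refine ih₂ fun Y => ?_
    by_cases hYX : Y = X
    · subst hYX
      rw [Function.update_self]
      exact (isPCTerm_shell e₁).subst hσ
    · rw [Function.update_of_ne hYX]; exact hσ Y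

/-! ### Refinement and let-rewriting steps -/

/-- `Refines P e' e`: in every environment, each value of `e'` is a value of `e`. -/
def Refines (P : Program S V) (e' e : PLExp S V) : Prop :=
  ∀ σ : Subst S V, σ.IsPCSubst → ∀ t, eval P e' σ t → eval P e σ t

theorem Refines.app {h : S.Sym} {args args' : Fin (S.arity h) → PLExp S V}
    (H : ∀ i, Refines P (args' i) (args i)) : Refines P (app h args') (app h args) := by
  rintro σ hσ t (rfl | ⟨ts, hts, ht⟩)
  · exact Or.inl rfl
  · exact Or.inr ⟨ts, fun i => H i σ hσ _ (hts i), ht⟩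

theorem Refines.letIn {X : V} {e₁ e₁' e₂ e₂' : PLExp S V} (H₁ : Refines P e₁' e₁)
    (H₂ : Refines P e₂' e₂) : Refines P (letIn X e₁' e₂') (letIn X e₁ e₂) := by
  rintro σ hσ t ⟨t₁, h₁, h₂⟩
  exact ⟨t₁, H₁ σ hσ _ h₁, H₂ _ (hσ.update X (eval_isPCTerm h₁)) _ h₂⟩

theorem Refines.refl (e : PLExp S V) : Refines P e e := fun _ _ _ h => h

/-- Capture by the context is harmless: a captured variable merely gets another value in the
environment, and `Refines` covers all of them. -/
theorem Refines.plug {e e' : PLExp S V} (H : Refines P e' e) (C : Ctx S V) :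
    Refines P (C.plug e') (C.plug e) := by
  induction C with
  | hole => exact H
  | app h i args C ih =>
    refine Refines.app fun j => ?_
    by_cases hj : j = i
    · subst hj; simpa using ih
    · simpa [Function.update_of_ne hj] using Refines.refl _
  | letDef X C e ih => exact ih.letIn (.refl _)
  | letBody X e C ih => exact (Refines.refl _).letIn ih

theorem eval_rename {X Z : V} {e₁ e₂ : PLExp S V} (hZ : Z ∉ e₂.FV) {σ : Subst S V}
    {t : PLExp S V} :
    eval P (letIn Z e₁ (e₂.subst (single X (var Z)))) σ t ↔ eval P (letIn X e₁ e₂) σ t := by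
  refine exists_congr fun t₁ => and_congr Iff.rfl ?_
  rw [eval_subst (Subst.IsPCSubst.single X (t := var Z) trivial).2, single_subst]
  refine eval_congr fun Y hY => ?_
  by_cases hYX : Y = X
  · subst hYX; simp [PLExp.subst]
  · rw [Function.update_of_ne hYX, Function.update_of_ne hYX, Function.update_of_ne]
    exact fun h => hZ (h ▸ hY)

theorem AlphaEq.refines {e e' : PLExp S V} (h : AlphaEq e e') :
    Refines P e' e ∧ Refines P e e' := by
  induction h with
  | rename X Z e₁ e₂ hZ =>
    exact ⟨fun σ _ t h => (eval_rename hZ).1 h, fun σ _ t h => (eval_rename hZ).2 h⟩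
  | refl e => exact ⟨.refl e, .refl e⟩
  | symm _ ih => exact ih.symm
  | trans _ _ ih₁ ih₂ =>
    exact ⟨fun σ hσ t h => ih₁.1 σ hσ t (ih₂.1 σ hσ t h),
      fun σ hσ t h => ih₂.2 σ hσ t (ih₁.2 σ hσ t h)⟩
  | app h args args' _ ih => exact ⟨.app fun i => (ih i).1, .app fun i => (ih i).2⟩
  | letIn X _ _ ih₁ ih₂ => exact ⟨ih₁.1.letIn ih₂.1, ih₁.2.letIn ih₂.2⟩

theorem PeelStep.refines {e e' : PLExp S V} (h : PeelStep e e') : Refines P e' e := by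
  intro σ hσ t ht
  cases h with
  | letIn h args i X _ hX =>
    obtain ⟨t₁, h₁, rfl | ⟨ts, hts, H⟩⟩ := ht
    · exact Or.inl rfl
    · refine Or.inr ⟨ts, fun j => ?_, H⟩
      have hj := hts j
      by_cases hji : j = i
      · subst hji
        -- The argument replaced by `X` has a value below `t₁`, hence one of the original argument
        -- by downward closure.
        simp only [Function.update_self, eval] at hj
        exact eval_mono h₁ hj
      · rw [Function.update_of_ne hji] at hj
        exact (eval_update_of_notMem fun h' => hX (mem_FV_app.2 ⟨j, h'⟩)).1 hj
  | bind X s e hs =>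
    rw [eval_subst (Subst.IsPCSubst.single X hs.isPCTerm).2, single_subst] at ht
    exact ⟨_, (eval_iff_approx hs.isPCTerm).2 (Approx.refl (hs.isPCTerm.subst hσ.2)), ht⟩
  -- The discarded definition need not be evaluated: `⊥` is always one of its values.
  | elim X e₁ _ hX => exact ⟨bot, eval_bot P e₁ σ, (eval_update_of_notMem hX).2 ht⟩
  | flat X Y e₁ e₂ e₃ hY =>
    obtain ⟨t₁, h₁, t₂, h₂, h₃⟩ := ht
    refine ⟨t₂, ⟨t₁, h₁, h₂⟩, (eval_congr fun Z hZ => ?_).1 h₃⟩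
    by_cases hZX : Z = X
    · subst hZX; simp
    · rw [Function.update_of_ne hZX, Function.update_of_ne hZX, Function.update_of_ne]
      exact fun h => hY (h ▸ hZ)

/-- The composite of `θ` with the environment is the matching substitution for (OR). Patterns have
no lets, so composition is exact there; the right-hand side may have lets and goes through
`eval_subst`. -/
theorem refines_fapp {R : ProgRule S V} (hR : R ∈ P) {θ : Subst S V} (hθ : θ.IsCSubst) :
    Refines P (R.rhs.subst θ) (fn R.f fun i => (R.pats i).subst θ) := by
  intro σ hσ t ht
  have hθ' := hθ.isPCSubst
  have hcomp := hθ'.comp hσ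
  refine Or.inr ⟨_, fun i => ?_,
    .fn R _ t hR hcomp ((CRWLlet_subst_iff_eval hcomp).2 ((eval_subst hθ'.2).1 ht))⟩
  have hp := (R.pats_cterm i).isPCTerm
  rw [eval_iff_approx (hp.subst hθ'.2), hp.letFree.subst_subst]
  exact Approx.refl (hp.subst hcomp.2)

theorem Step.refines {e e' : PLExp S V} (h : Step P e e') : Refines P e' e := by
  cases h with
  | fapp R θ hR hθ => exact refines_fapp hR hθ
  | peel h => exact h.refines
  | contxFapp C R θ _ hR hθ _ => exact (refines_fapp hR hθ).plug C
  | contxPeel C _ h => exact h.refines.plug C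

theorem LetRewrites.refines {e e' : PLExp S V} (h : LetRewrites P e e') : Refines P e' e := by
  induction h with
  | refl => exact .refl e
  | tail _ h ih =>
    intro σ hσ t ht
    exact ih σ hσ t (h.elim (fun h => h.refines σ hσ t ht) fun h =>
      (AlphaEq.refines h).1 σ hσ t ht)

/-! ### Shells and the let-free calculus -/

theorem LetRewrites.CRWLlet_shell {e e' : PLExp S V} (h : LetRewrites P e e') :
    CRWLlet P e e'.shell := by
  have h' := eval_shell P e' Subst.isPCSubst_var.2
  rw [subst_var] at h'
  exact CRWLlet_iff_eval.2 (h.refines _ Subst.isPCSubst_var _ h')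

/-- Let-freeness is passed up to every premise: partial c-terms contain no lets, so neither does an
instantiated right-hand side. -/
theorem CRWLlet.toCRWL (hP : P.LetFree) {e t : PLExp S V} (h : CRWLlet P e t)
    (he : e.LetFree) : CRWL P e t := by
  induction h with
  | B e => exact .B e he
  | RR X => exact .RR X
  | DC c es ts _ ih => exact .DC c es ts fun i => ih i (he i)
  | OR R θ es t hR hθ _ _ ih₁ ih₂ =>
    exact .OR R θ es t hR hθ (fun i => ih₁ i (he i))
      (ih₂ ((hP R hR).subst fun X => (hθ.2 X).letFree))
  | Let => exact he.elim

end Soundness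

end LetRw

theorem mainTheorem2 {S : LetRw.Signature} {V : Type*} [DecidableEq V] [Infinite V]
    (P : LetRw.Program S V) (e : LetRw.PLExp S V) (he : e.IsLExp) :
    (∀ e' : LetRw.PLExp S V, e'.IsLExp → LetRw.LetRewrites P e e' →
      LetRw.CRWLlet P e e'.shell) ∧
    (∀ t : LetRw.PLExp S V, t.IsCTerm → LetRw.LetRewrites P e t → LetRw.CRWLlet P e t) ∧
    (P.LetFree → e.LetFree →
      (∀ e' : LetRw.PLExp S V, e'.IsLExp → LetRw.LetRewrites P e e' →
        LetRw.CRWL P e e'.shell) ∧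
      (∀ t : LetRw.PLExp S V, t.IsCTerm → LetRw.LetRewrites P e t → LetRw.CRWL P e t)) ∧
    (∀ e' : LetRw.PLExp S V, e'.IsLExp → LetRw.LetRewrites P e e' →
      ∀ θ, LetRw.hyperDen P e' θ ⊆ LetRw.hyperDen P e θ) := by
  have shell : ∀ e' : LetRw.PLExp S V, LetRw.LetRewrites P e e' → LetRw.CRWLlet P e e'.shell :=
    fun _ h => h.CRWLlet_shell
  have cterm : ∀ t : LetRw.PLExp S V, t.IsCTerm → LetRw.LetRewrites P e t →
      LetRw.CRWLlet P e t := fun t ht h => ht.shell_eq ▸ shell t h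
  refine ⟨fun e' _ h => shell e' h, cterm, fun hP hl => ⟨fun e' _ h => (shell e' h).toCRWL hP hl,
    fun t ht h => (cterm t ht h).toCRWL hP hl⟩, fun e' _ h θ t ht => ⟨ht.1, ?_⟩⟩
  exact (LetRw.CRWLlet_subst_iff_eval θ.2).2
    (h.refines θ.1 θ.2 t ((LetRw.CRWLlet_subst_iff_eval θ.2).1 ht.2))
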